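/- Let $m$ be the Lebesgue measure on the unit circle $\mathbb T$, normalized by $m(\mathbb T)=1$. For a finite positive measure $\rho$ on $\mathbb T$ put $$e_n(\rho)=\min_{q_0,\dots,q_{n-1}\in\mathbb C}\Bigl(\int_{\mathbb T}\bigl|q_0+q_1t+\dots+q_{n-1}t^{n-1}+t^n\bigr|^2\,d\rho(t)\Bigr)^{1/2}.$$ For a lower semicontinuous function $H\colon\mathbb T\to[0,+\infty]$ and $a\ge 0$ let $\lambda_H(a)=m\{H>a\}$, and let $\lambda_H^*(a)$ be the (normalized) length of the longest open arc contained in the open set $\{H>a\}$. Let $c>0$, $q<2$ and $\kappa<1$. There is a constant $K>0$, depending only on $c$, $q$ and $\kappa$, such that the following holds. Let $H\colon\mathbb T\to[0,+\infty]$ be lower semicontinuous with $\int_{\mathbb T}H\,dm=+\infty$ and $m\{H=+\infty\}\le\kappa$, let $d\rho=e^{-H}\,dm$ (with $e^{-\infty}=0$), and suppose that $$\lambda_H^*(a)\ge c\,\lambda_H(a)\ \text{ for all sufficiently large } a,\qquad \limsup_{a\to\infty}\frac{\lambda_H(a)}{\lambda_H(2a)}\le q .$$ Then there is $n_0$ (depending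 on $H$) such that for every $n\ge n_0$ and every solution $A$ of the equation $n\lambda_H(A)=A$, $$K^{-1}A\lambda_H(A)\le|\log e_n(\rho)|\le K\,A\lambda_H(A).$$ -/

import Mathlib

open MeasureTheory Filter Topology
open scoped ENNReal

noncomputable section

namespace SzegoRate

/-- The prediction error `e_n(ρ)`: the distance in `L²(ρ)` from `t ^ n` to the polynomials of degree
at most `n - 1`. The unit circle is identified with `ℝ / ℤ` by `x ↦ t = exp (2 π i x)`. -/
def predErr (ρ : Measure UnitAddCircle) (n : ℕ) : ℝ :=
  ⨅ q : Fin n → ℂ, √(∫ x : UnitAddCircle,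
    ‖(∑ j : Fin n, q j * (AddCircle.toCircle x : ℂ) ^ (j : ℕ))
        + (AddCircle.toCircle x : ℂ) ^ n‖ ^ 2 ∂ρ)

/-- The measure `e^{-H} dm`, where `m` is normalized Lebesgue measure on the circle
(`volume` on `UnitAddCircle` has total mass one) and `e^{-∞} = 0`. -/
def expMeasure (H : UnitAddCircle → ℝ≥0∞) : Measure UnitAddCircle :=
  volume.withDensity fun x => EReal.exp (-(H x : EReal))

/-- The distribution function `λ_H(a) = m {H > a}` (for `a ≥ 0`). -/
def distrib (H : UnitAddCircle → ℝ≥0∞) (a : ℝ) : ℝ :=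
  volume.real {x : UnitAddCircle | ENNReal.ofReal a < H x}

/-- `λ*_H(a)`, the normalized length of the longest open arc contained in `{H > a}`
(zero if there is none, one if `{H > a}` is the whole circle). -/
def longestArc (H : UnitAddCircle → ℝ≥0∞) (a : ℝ) : ℝ :=
  sSup {l : ℝ | 0 ≤ l ∧ l ≤ 1 ∧ ∃ α : ℝ, ∀ θ ∈ Set.Ioo α (α + l),
    ENNReal.ofReal a < H (θ : UnitAddCircle)}

end SzegoRate

end

namespace SzegoRate

/-! Write `λ = λ_H(A)` and `F = {H > A}`, where `nλ = A`. Both bounds come from what a polynomial of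
degree `n` can do on `F`: at scale `λ` its logarithm can vary by about `nλ = A`, the level that
defines `F`.

Lower bound for `e_n`. Let `P` be monic of degree `n` without zeros on the circle, and `U = log
|P|²`. Pushing a point inward to radius `r` costs at most `2n(1 - r)` in a Poisson estimate of `U`
(`log_norm_prod_sub_le_integral_poisson`). If `∫ |P|² dρ ≤ e^{-T}` with `T ≥ 0`, then `∫ e^U ≤ e^A`
off `F`, and with `1 - r` comparable to `λ` this yields `U ≤ const · A` on the whole circle
(`le_of_le_integral_poisson`). By Jensen's formula the mean of `U` is nonnegative. The part over `F`
is at most `const · Aλ`, while off `F` one has `U ≤ H - T + e^{T-H+U}`. Hence `T` is bounded by a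
constant times `Aλ + ∫_{H ≤ A} H + 1` (`mul_le_of_exp_mul_integral_le_one`). The doubling ratio
below `2` makes the truncated integral `O(Aλ)` by a geometric series (`exists_truncIntegral_le`),
and makes `Aλ` tend to infinity, which absorbs additive constants.

Upper bound for `e_n`. On an arc of half-width `h` comparable to `λ` inside `F`, the weight is at
most `e^{-A}`. The function `exp (B * arcFun h z)`, with `B` a small multiple of `nh`, is at most
`1` in modulus off the arc, at most `e^{19B}` on it, and at least `e^{Bh/4}` at the origin. Its
Taylor polynomial of degree `n`, rotated, reversed and normalized to be monic, gives an error of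
order `e^{-Bh/4}`, and `Bh` is comparable to `nλ² = Aλ` (`predErr_expMeasure_le`, `tail_le_one`). -/

theorem norm_toCircle (x : UnitAddCircle) : ‖(AddCircle.toCircle x : ℂ)‖ = 1 :=
  Circle.norm_coe _

/-! ### Poisson estimates for `log |z - a|`. -/

theorem circleAverage_eq_integral (f : ℂ → ℝ) :
    Real.circleAverage f 0 1 = ∫ x : UnitAddCircle, f (AddCircle.toCircle x) := by
  rw [← UnitAddCircle.intervalIntegral_preimage 0, Real.circleAverage_def]
  have h := intervalIntegral.integral_comp_mul_left (a := 0) (b := 1)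
    (fun θ => f (circleMap 0 1 θ)) (c := 2 * Real.pi) (by positivity)
  rw [mul_zero, mul_one] at h
  rw [← h, zero_add]
  refine intervalIntegral.integral_congr fun x _ => ?_
  simp [AddCircle.toCircle_apply_mk, circleMap, Circle.coe_exp]

/-- After squaring, the difference of the two sides is affine in `Re (z * conj a)` with slope `2(1 -
r)²`, so the worst case is `Re (z * conj a) = -‖a‖`. There it factors with `(1 - r)(‖a‖ - 1) ≥ 0` as
one factor. -/
theorem norm_sub_le_of_one_le_norm {z a : ℂ} {r : ℝ} (hz : ‖z‖ = 1) (ha : 1 ≤ ‖a‖) (h0 : 0 ≤ r)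
    (h1 : r ≤ 1) : (1 + r) * ‖z - a‖ ≤ 2 * ‖r * z - a‖ := by
  have hx : -‖a‖ ≤ (z * (starRingEnd ℂ) a).re := by
    have := Complex.abs_re_le_norm (z * (starRingEnd ℂ) a)
    rw [norm_mul, hz, one_mul, RCLike.norm_conj] at this
    exact (abs_le.1 this).1
  have e1 : ‖z - a‖ ^ 2 = 1 + ‖a‖ ^ 2 - 2 * (z * (starRingEnd ℂ) a).re := by
    rw [← Complex.normSq_eq_norm_sq, Complex.normSq_sub, Complex.normSq_eq_norm_sq,
      Complex.normSq_eq_norm_sq, hz]; ring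
  have e2 : ‖r * z - a‖ ^ 2 = r ^ 2 + ‖a‖ ^ 2 - 2 * r * (z * (starRingEnd ℂ) a).re := by
    rw [← Complex.normSq_eq_norm_sq, Complex.normSq_sub, Complex.normSq_eq_norm_sq,
      Complex.normSq_eq_norm_sq, norm_mul, hz, Complex.norm_real, Real.norm_eq_abs, mul_one,
      sq_abs, mul_assoc (r : ℂ), Complex.re_ofReal_mul]; ring
  refine abs_le_of_sq_le_sq' (a := (1 + r) * ‖z - a‖) ?_ (by positivity) |>.2
  rw [mul_pow, mul_pow, e1, e2]
  have k1 : 0 ≤ (1 - r) ^ 2 * ((z * (starRingEnd ℂ) a).re + ‖a‖) :=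
    mul_nonneg (sq_nonneg _) (by linarith)
  have k2 : 0 ≤ ((1 - r) * (‖a‖ - 1)) * (2 * (r + ‖a‖) + (1 + r) * (1 + ‖a‖)) :=
    mul_nonneg (mul_nonneg (by linarith) (by linarith)) (by positivity)
  nlinarith

theorem log_norm_sub_le_log_norm_sub {z a : ℂ} {r : ℝ} (hz : ‖z‖ = 1) (ha : 1 < ‖a‖) (h0 : 0 ≤ r)
    (h1 : r ≤ 1) : Real.log ‖z - a‖ ≤ (1 - r) + Real.log ‖r * z - a‖ := by
  have hza : 0 < ‖z - a‖ := norm_pos_iff.2 (sub_ne_zero.2 (by rintro rfl; linarith))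
  have hra : 0 < ‖r * z - a‖ := by
    have := norm_sub_le_of_one_le_norm hz ha.le h0 h1
    have : 0 < (1 + r) * ‖z - a‖ := by positivity
    linarith
  have h2 : ‖z - a‖ ≤ (2 / (1 + r)) * ‖r * z - a‖ := by
    rw [div_mul_eq_mul_div, le_div_iff₀ (by linarith), mul_comm]
    exact norm_sub_le_of_one_le_norm hz ha.le h0 h1
  have h3 : Real.log (2 / (1 + r)) ≤ 1 - r := by
    refine (Real.log_le_sub_one_of_pos (by positivity)).trans ?_
    rw [div_sub_one (by linarith), div_le_iff₀ (by linarith)]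
    nlinarith
  calc Real.log ‖z - a‖ ≤ Real.log ((2 / (1 + r)) * ‖r * z - a‖) := Real.log_le_log hza h2
    _ = Real.log (2 / (1 + r)) + Real.log ‖r * z - a‖ :=
      Real.log_mul (by positivity) hra.ne'
    _ ≤ _ := by linarith

theorem circleAverage_poissonKernel_log_norm_sub {w a : ℂ} (hw : ‖w‖ < 1) (ha : 1 < ‖a‖) :
    Real.circleAverage (poissonKernel 0 w • fun ζ => Real.log ‖ζ - a‖) 0 1
      = Real.log ‖w - a‖ := by
  refine InnerProductSpace.HarmonicOnNhd.circleAverage_poissonKernel_smul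
    (f := fun ζ => Real.log ‖ζ - a‖) (fun x hx => ?_) (by simpa using hw)
  refine AnalyticAt.harmonicAt_log_norm (f := fun ζ => ζ - a) (by fun_prop) ?_
  rw [sub_ne_zero]
  rintro rfl
  simp at hx
  linarith

theorem circleAverage_poissonKernel {w : ℂ} (hw : ‖w‖ < 1) :
    Real.circleAverage (poissonKernel 0 w) 0 1 = 1 := by
  have := InnerProductSpace.HarmonicOnNhd.circleAverage_poissonKernel_smul (f := fun _ => (1 : ℝ))
    (c := 0) (R := 1) (w := w) (fun x hx => InnerProductSpace.harmonicAt_const _) (by simpa using hw)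
  convert this using 2
  ext; simp

/-- The Poisson kernel of the unit disc on the circle `ℝ / ℤ`. -/
noncomputable def poisson (w : ℂ) (x : UnitAddCircle) : ℝ := poissonKernel 0 w (AddCircle.toCircle x)

theorem poisson_eq (w : ℂ) (x : UnitAddCircle) :
    poisson w x = (1 - ‖w‖ ^ 2) / ‖(AddCircle.toCircle x : ℂ) - w‖ ^ 2 := by
  simp [poisson, poissonKernel_def, norm_toCircle]

theorem continuous_toCircle : Continuous fun x : UnitAddCircle => (AddCircle.toCircle x : ℂ) :=
  continuous_subtype_val.comp AddCircle.continuous_toCircle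

theorem continuous_poisson {w : ℂ} (hw : ‖w‖ < 1) : Continuous (poisson w) := by
  simp_rw [funext (poisson_eq w)]
  refine continuous_const.div ((continuous_toCircle.sub continuous_const).norm.pow 2) fun x h => ?_
  have h2 : (AddCircle.toCircle x : ℂ) - w = 0 := by simpa using h
  have := norm_toCircle x
  rw [sub_eq_zero.1 h2] at this
  linarith

theorem poisson_nonneg {w : ℂ} (hw : ‖w‖ < 1) (x : UnitAddCircle) : 0 ≤ poisson w x := by
  rw [poisson_eq]
  have := norm_nonneg w
  exact div_nonneg (by nlinarith) (by positivity)

theorem poisson_le {w : ℂ} (hw : ‖w‖ < 1) (x : UnitAddCircle) : poisson w x ≤ 2 / (1 - ‖w‖) := by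
  rw [poisson_eq]
  have h0 := norm_nonneg w
  have h1 : 1 - ‖w‖ ≤ ‖(AddCircle.toCircle x : ℂ) - w‖ := by
    simpa only [norm_toCircle] using norm_sub_norm_le (AddCircle.toCircle x : ℂ) w
  rw [div_le_div_iff₀ (by nlinarith) (by linarith)]
  nlinarith [mul_self_le_mul_self (by linarith) h1]

theorem integral_poisson {w : ℂ} (hw : ‖w‖ < 1) : ∫ x, poisson w x = 1 := by
  exact (circleAverage_eq_integral _).symm.trans (circleAverage_poissonKernel hw)

/-- For `‖a‖ > 1` the function `log ‖ζ - a‖` is harmonic near the closed disc, so its Poisson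
integral is its value at `r * z`. A zero inside the disc is reflected to `1 / conj a`, which changes
the logarithm on the circle only by the constant `log ‖a‖`. -/
theorem log_norm_sub_le_integral_poisson {z a : ℂ} {r : ℝ} (hz : ‖z‖ = 1) (ha : ‖a‖ ≠ 1)
    (h0 : 0 ≤ r) (h1 : r < 1) :
    Real.log ‖z - a‖ ≤ (1 - r) +
      ∫ x, poisson (r * z) x * Real.log ‖(AddCircle.toCircle x : ℂ) - a‖ := by
  have hw : ‖(r * z : ℂ)‖ < 1 := by simpa [hz, abs_of_nonneg h0] using h1
  have key : ∀ b : ℂ, 1 < ‖b‖ → Real.log ‖z - b‖ ≤ (1 - r) +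
      ∫ x, poisson (r * z) x * Real.log ‖(AddCircle.toCircle x : ℂ) - b‖ := by
    intro b hb
    refine (log_norm_sub_le_log_norm_sub hz hb h0 h1.le).trans_eq ?_
    rw [← circleAverage_poissonKernel_log_norm_sub hw hb, circleAverage_eq_integral]
    rfl
  rcases lt_or_gt_of_ne ha with ha | ha
  · rcases eq_or_ne a 0 with rfl | ha0
    · simp [hz, norm_toCircle, h1.le]
    have hn : 0 < ‖a‖ := norm_pos_iff.2 ha0
    have hb : 1 < ‖((starRingEnd ℂ) a)⁻¹‖ := by
      rw [norm_inv, RCLike.norm_conj]; exact (one_lt_inv₀ hn).2 ha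
    have hr : ∀ ζ : ℂ, ‖ζ‖ = 1 →
        Real.log ‖ζ - a‖ = Real.log ‖a‖ + Real.log ‖ζ - ((starRingEnd ℂ) a)⁻¹‖ := by
      intro ζ hζ
      have hne : ζ - ((starRingEnd ℂ) a)⁻¹ ≠ 0 := by
        rw [sub_ne_zero]; rintro rfl; linarith
      rw [← Real.log_mul hn.ne' (norm_ne_zero_iff.2 hne)]
      congr 1
      have ha' : (starRingEnd ℂ) a ≠ 0 := by simpa using ha0
      have hζ' : ζ * (starRingEnd ℂ) ζ = 1 := by
        rw [Complex.mul_conj, Complex.normSq_eq_norm_sq, hζ]; simp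
      rw [← RCLike.norm_conj a, ← norm_mul, mul_sub, mul_inv_cancel₀ ha', ← RCLike.norm_conj,
        ← one_mul ‖_‖, ← hζ, ← norm_mul, ← norm_neg]
      congr 1
      simp only [map_sub]
      linear_combination -hζ'
    rw [hr z hz]
    have e : ∀ x : UnitAddCircle, poisson (r * z) x * Real.log ‖(AddCircle.toCircle x : ℂ) - a‖
        = Real.log ‖a‖ * poisson (r * z) x +
          poisson (r * z) x * Real.log ‖(AddCircle.toCircle x : ℂ) - ((starRingEnd ℂ) a)⁻¹‖ := by
      intro x
      rw [hr _ (norm_toCircle x)]; ring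
    have hc := continuous_poisson hw
    simp_rw [e]
    rw [integral_add, integral_const_mul, integral_poisson hw]
    · linarith [key _ hb]
    · exact (continuous_const.mul hc).integrable_of_hasCompactSupport
        (HasCompactSupport.of_compactSpace _)
    · refine Continuous.integrable_of_hasCompactSupport (hc.mul (Continuous.log ?_ fun x => ?_))
        (HasCompactSupport.of_compactSpace _)
      · exact (continuous_toCircle.sub continuous_const).norm
      · rw [norm_ne_zero_iff, sub_ne_zero]
        intro h
        have := norm_toCircle x
        rw [h] at this; linarith
  · exact key a ha

/-! ### Logarithms of products over the zeros. -/

theorem integrable_of_continuous {f : UnitAddCircle → ℝ} (hf : Continuous f) : Integrable f :=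
  hf.integrable_of_hasCompactSupport (HasCompactSupport.of_compactSpace _)

theorem volume_real_univ : volume.real (Set.univ : Set UnitAddCircle) = 1 := by
  simp [Measure.real]

theorem sub_ne_zero_of_norm_ne_one {z a : ℂ} (hz : ‖z‖ = 1) (ha : ‖a‖ ≠ 1) : z - a ≠ 0 := by
  rw [sub_ne_zero]; rintro rfl; exact ha hz

theorem prod_sub_ne_zero {s : Multiset ℂ} (hs : ∀ a ∈ s, ‖a‖ ≠ 1) {z : ℂ} (hz : ‖z‖ = 1) :
    (s.map (z - ·)).prod ≠ 0 := by
  rw [Ne, Multiset.prod_eq_zero_iff]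
  intro h
  obtain ⟨a, ha, h⟩ := Multiset.mem_map.1 h
  exact sub_ne_zero_of_norm_ne_one hz (hs a ha) h

theorem continuous_log_norm_prod_sub {s : Multiset ℂ} (hs : ∀ a ∈ s, ‖a‖ ≠ 1) :
    Continuous fun x : UnitAddCircle =>
      Real.log ‖(s.map ((AddCircle.toCircle x : ℂ) - ·)).prod‖ := by
  refine Continuous.log ?_ fun x => norm_ne_zero_iff.2 (prod_sub_ne_zero hs (norm_toCircle x))
  exact (continuous_multiset_prod s fun a _ => continuous_toCircle.sub continuous_const).norm

theorem log_norm_prod_sub_cons {s : Multiset ℂ} {a : ℂ} (hs : ∀ b ∈ a ::ₘ s, ‖b‖ ≠ 1) {z : ℂ}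
    (hz : ‖z‖ = 1) : Real.log ‖((a ::ₘ s).map (z - ·)).prod‖ =
      Real.log ‖z - a‖ + Real.log ‖(s.map (z - ·)).prod‖ := by
  rw [Multiset.map_cons, Multiset.prod_cons, norm_mul, Real.log_mul]
  · exact norm_ne_zero_iff.2 (sub_ne_zero_of_norm_ne_one hz (hs a (Multiset.mem_cons_self a s)))
  · exact norm_ne_zero_iff.2
      (prod_sub_ne_zero (fun b hb => hs b (Multiset.mem_cons_of_mem hb)) hz)

theorem continuous_log_norm_sub {a : ℂ} (ha : ‖a‖ ≠ 1) :
    Continuous fun x : UnitAddCircle => Real.log ‖(AddCircle.toCircle x : ℂ) - a‖ :=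
  Continuous.log (continuous_toCircle.sub continuous_const).norm fun x =>
    norm_ne_zero_iff.2 (sub_ne_zero_of_norm_ne_one (norm_toCircle x) ha)

theorem log_norm_prod_sub_le_integral_poisson {z : ℂ} {r : ℝ} (hz : ‖z‖ = 1) (h0 : 0 ≤ r)
    (h1 : r < 1) (s : Multiset ℂ) (hs : ∀ a ∈ s, ‖a‖ ≠ 1) :
    Real.log ‖(s.map (z - ·)).prod‖ ≤ s.card * (1 - r) + ∫ x, poisson (r * z) x *
      Real.log ‖(s.map ((AddCircle.toCircle x : ℂ) - ·)).prod‖ := by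
  have hw : ‖(r * z : ℂ)‖ < 1 := by simpa [hz, abs_of_nonneg h0] using h1
  induction s using Multiset.induction with
  | empty => simp
  | cons a s ih =>
    have hs' : ∀ b ∈ s, ‖b‖ ≠ 1 := fun b hb => hs b (Multiset.mem_cons_of_mem hb)
    have ha := hs a (Multiset.mem_cons_self a s)
    have hc := continuous_poisson hw
    rw [log_norm_prod_sub_cons hs hz]
    simp_rw [fun x => log_norm_prod_sub_cons hs (norm_toCircle x), mul_add]
    rw [integral_add (integrable_of_continuous (hc.fun_mul (continuous_log_norm_sub ha)))
      (integrable_of_continuous (hc.fun_mul (continuous_log_norm_prod_sub hs')))]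
    have := log_norm_sub_le_integral_poisson hz ha h0 h1
    have := ih hs'
    simp only [Multiset.card_cons, Nat.cast_add, Nat.cast_one, add_mul, one_mul]
    linarith

theorem integral_log_norm_prod_sub_nonneg (s : Multiset ℂ) (hs : ∀ a ∈ s, ‖a‖ ≠ 1) :
    0 ≤ ∫ x : UnitAddCircle, Real.log ‖(s.map ((AddCircle.toCircle x : ℂ) - ·)).prod‖ := by
  induction s using Multiset.induction with
  | empty => simp
  | cons a s ih =>
    have hs' : ∀ b ∈ s, ‖b‖ ≠ 1 := fun b hb => hs b (Multiset.mem_cons_of_mem hb)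
    have ha := hs a (Multiset.mem_cons_self a s)
    simp_rw [fun x => log_norm_prod_sub_cons hs (norm_toCircle x)]
    rw [integral_add (integrable_of_continuous (continuous_log_norm_sub ha))
      (integrable_of_continuous (continuous_log_norm_prod_sub hs'))]
    refine add_nonneg ?_ (ih hs')
    have h := circleAverage_eq_integral fun ζ => Real.log ‖ζ - a‖
    rw [circleAverage_log_norm_sub_const_eq_posLog] at h
    exact h ▸ Real.posLog_nonneg

/-! ### Uniform upper bound for `U = log |P|²`. -/

theorem integral_poisson_mul_compl_le {U : UnitAddCircle → ℝ} (hU : Continuous U)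
    {F : Set UnitAddCircle} {A : ℝ} (hA : 0 ≤ A)
    (hE : ∫ x in Fᶜ, Real.exp (U x) ≤ Real.exp A) {w : ℂ} (hw : ‖w‖ < 1) :
    ∫ x in Fᶜ, poisson w x * U x ≤ A + 2 / (1 - ‖w‖) := by
  have hc := continuous_poisson hw
  have hi : Integrable fun x => A * poisson w x :=
    integrable_of_continuous (continuous_const.mul hc)
  have hj : Integrable fun x => 2 / (1 - ‖w‖) * Real.exp (-A) * Real.exp (U x) :=
    integrable_of_continuous (continuous_const.mul (Real.continuous_exp.comp hU))
  have hm : 0 ≤ 2 / (1 - ‖w‖) := div_nonneg zero_le_two (by linarith)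
  calc ∫ x in Fᶜ, poisson w x * U x
      ≤ ∫ x in Fᶜ, (A * poisson w x + 2 / (1 - ‖w‖) * Real.exp (-A) * Real.exp (U x)) := by
        refine setIntegral_mono (integrable_of_continuous (hc.fun_mul hU)).integrableOn
          (hi.add hj).integrableOn fun x => ?_
        -- This plays the role of Jensen's inequality: `U ≤ A + e^{U-A}`, and the exponential term
        -- has integral at most `1` off `F`.
        have h1 : U x - A ≤ Real.exp (-A) * Real.exp (U x) := by
          rw [← Real.exp_add]
          linarith [Real.add_one_le_exp (-A + U x)]
        have h2 := mul_le_mul_of_nonneg_left h1 (poisson_nonneg hw x)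
        have h3 := mul_le_mul_of_nonneg_right (poisson_le hw x)
          (by positivity : 0 ≤ Real.exp (-A) * Real.exp (U x))
        show poisson w x * U x ≤ A * poisson w x + 2 / (1 - ‖w‖) * Real.exp (-A) * Real.exp (U x)
        linarith
    _ = A * (∫ x in Fᶜ, poisson w x) +
          2 / (1 - ‖w‖) * Real.exp (-A) * ∫ x in Fᶜ, Real.exp (U x) := by
        rw [integral_add hi.integrableOn hj.integrableOn, integral_const_mul, integral_const_mul]
    _ ≤ A * 1 + 2 / (1 - ‖w‖) * Real.exp (-A) * Real.exp A := by
        refine add_le_add (mul_le_mul_of_nonneg_left ?_ hA)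
          (mul_le_mul_of_nonneg_left hE (by positivity))
        exact (setIntegral_le_integral (integrable_of_continuous hc)
          (ae_of_all _ (poisson_nonneg hw))).trans_eq (integral_poisson hw)
    _ = _ := by rw [mul_assoc, ← Real.exp_add]; simp

/-- Apply the Poisson estimate at a maximum point of `U`. The part over `F` returns the maximum
times the Poisson mass of `F`; once that mass is bounded away from `1`, the term can be absorbed on
the left. -/
theorem le_of_le_integral_poisson {U : UnitAddCircle → ℝ} (hU : Continuous U) {n : ℕ}
    (hP : ∀ (x : UnitAddCircle) (r : ℝ), 0 ≤ r → r < 1 → U x ≤ 2 * n * (1 - r) +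
      ∫ y, poisson (r * AddCircle.toCircle x) y * U y)
    (h0 : 0 ≤ ∫ x, U x) {F : Set UnitAddCircle} (hF : MeasurableSet F) {A κ : ℝ}
    (hκ : volume.real F ≤ κ) (hκ1 : κ < 1) (hpos : 0 < volume.real F)
    (hA : n * volume.real F = A) (hA1 : 1 ≤ A * volume.real F)
    (hE : ∫ x in Fᶜ, Real.exp (U x) ≤ Real.exp A) (x : UnitAddCircle) :
    U x ≤ 20 * A / (1 - κ) := by
  obtain ⟨y, -, hy⟩ := isCompact_univ.exists_isMaxOn ⟨x, Set.mem_univ x⟩ hU.continuousOn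
  replace hy : ∀ z, U z ≤ U y := fun z => hy (Set.mem_univ z)
  refine (hy x).trans ?_
  have hS : 0 ≤ U y := by
    refine h0.trans ((integral_mono (integrable_of_continuous hU) (integrable_const (U y)) hy).trans ?_)
    simp [volume_real_univ]
  have hA0 : 0 ≤ A := hA ▸ by positivity
  have hl1 : volume.real F ≤ 1 := by linarith
  have hA2 : 1 ≤ A := by nlinarith
  have hk0 : 0 < κ := hpos.trans_le hκ
  have step : ∀ r : ℝ, 0 ≤ r → r < 1 → ∀ m : ℝ,
      (∀ z, poisson (r * AddCircle.toCircle y) z ≤ m) →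
      U y ≤ 2 * n * (1 - r) + U y * (m * volume.real F) + (A + 2 / (1 - r)) := by
    intro r hr0 hr1 m hm
    have hwr : ‖(r * AddCircle.toCircle y : ℂ)‖ = r := by
      rw [norm_mul, norm_toCircle, mul_one, Complex.norm_real, Real.norm_eq_abs, abs_of_nonneg hr0]
    have hw : ‖(r * AddCircle.toCircle y : ℂ)‖ < 1 := hwr.trans_lt hr1
    have hc := continuous_poisson hw
    have h1 := hP y r hr0 hr1
    rw [← integral_add_compl hF (integrable_of_continuous (hc.fun_mul hU))] at h1
    have h2 := integral_poisson_mul_compl_le hU hA0 hE hw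
    rw [hwr] at h2
    have h3 : ∫ z in F, poisson (r * AddCircle.toCircle y) z * U z
        ≤ U y * (m * volume.real F) := by
      refine (setIntegral_mono (g := fun _ => m * U y)
        (integrable_of_continuous (hc.fun_mul hU)).integrableOn
        (integrable_const _).integrableOn fun z => ?_).trans_eq ?_
      · exact (mul_le_mul_of_nonneg_left (hy z) (poisson_nonneg hw z)).trans
          (mul_le_mul_of_nonneg_right (hm z) hS)
      · rw [setIntegral_const, smul_eq_mul]; ring
    linarith
  rw [le_div_iff₀ (by linarith)]
  rcases le_or_gt (volume.real F) (1 / 8) with hl | hl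
  -- With `1 - r = 4λ` the kernel is at most `1/(2λ)`, so `F` has Poisson mass at most `1/2`; the
  -- cost `2n(1 - r)` is `8A`, and `2/(1 - r) = 1/(2λ) ≤ A`.
  · have h := step (1 - 4 * volume.real F) (by linarith) (by linarith)
      (2 / (4 * volume.real F)) fun z => ?_
    · have e1 : 2 / (4 * volume.real F) * volume.real F = 1 / 2 := by field_simp; norm_num
      have e2 : 2 / (1 - (1 - 4 * volume.real F)) ≤ A := by
        rw [div_le_iff₀ (by linarith)]; linarith
      rw [e1] at h
      have : U y ≤ 20 * A := by linarith
      nlinarith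
    · refine (poisson_le ?_ z).trans_eq ?_ <;>
      rw [norm_mul, norm_toCircle, mul_one, Complex.norm_real, Real.norm_eq_abs,
        abs_of_nonneg (by linarith)]
      · linarith
      · ring
  -- For large `F` use the centre of the disc: the kernel is `1`, the mass of `F` is at most `κ`,
  -- and `n < 8A` because `λ > 1/8`.
  · have h := step 0 le_rfl zero_lt_one 1 fun z => by simp [poisson_eq, norm_toCircle]
    have h8 : (n : ℝ) ≤ 8 * A := by nlinarith [n.cast_nonneg (α := ℝ)]
    nlinarith

/-! ### The weight `e^{-H}` and the lower bound for zeros off the circle. -/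

/-- The density `e^{-H}` as a real-valued function. -/
noncomputable def weight (H : UnitAddCircle → ℝ≥0∞) (x : UnitAddCircle) : ℝ :=
  (EReal.exp (-(H x : EReal))).toReal

theorem measurable_exp_neg {H : UnitAddCircle → ℝ≥0∞} (hH : Measurable H) :
    Measurable fun x => EReal.exp (-(H x : EReal)) :=
  EReal.measurable_exp.comp (measurable_coe_ennreal_ereal.comp hH).neg

theorem exp_neg_le_one (H : UnitAddCircle → ℝ≥0∞) (x : UnitAddCircle) :
    EReal.exp (-(H x : EReal)) ≤ 1 := by
  rw [EReal.exp_le_one_iff, EReal.neg_le, neg_zero]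
  exact EReal.coe_ennreal_nonneg _

theorem weight_nonneg (H : UnitAddCircle → ℝ≥0∞) (x : UnitAddCircle) : 0 ≤ weight H x :=
  ENNReal.toReal_nonneg

theorem weight_le_one (H : UnitAddCircle → ℝ≥0∞) (x : UnitAddCircle) : weight H x ≤ 1 :=
  ENNReal.toReal_le_of_le_ofReal zero_le_one (by simpa using exp_neg_le_one H x)

theorem measurable_weight {H : UnitAddCircle → ℝ≥0∞} (hH : Measurable H) : Measurable (weight H) :=
  (measurable_exp_neg hH).ennreal_toReal

theorem weight_of_ne_top {H : UnitAddCircle → ℝ≥0∞} {x : UnitAddCircle} (h : H x ≠ ∞) :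
    weight H x = Real.exp (-(H x).toReal) := by
  have : (H x : EReal) = ((H x).toReal : ℝ) := (EReal.coe_ennreal_toReal h).symm
  rw [weight, this, ← EReal.coe_neg, EReal.exp_coe, ENNReal.toReal_ofReal (Real.exp_pos _).le]

theorem weight_le_of_lt {H : UnitAddCircle → ℝ≥0∞} {x : UnitAddCircle} {A : ℝ} (hA : 0 ≤ A)
    (h : ENNReal.ofReal A < H x) : weight H x ≤ Real.exp (-A) := by
  rcases eq_or_ne (H x) ∞ with ht | ht
  · rw [weight, ht]; simp [(Real.exp_pos _).le]
  · rw [weight_of_ne_top ht, Real.exp_le_exp, neg_le_neg_iff]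
    exact (ENNReal.ofReal_lt_iff_lt_toReal hA ht).1 h |>.le

theorem integral_expMeasure {H : UnitAddCircle → ℝ≥0∞} (hH : Measurable H)
    (f : UnitAddCircle → ℝ) : ∫ x, f x ∂(expMeasure H) = ∫ x, weight H x * f x := by
  rw [expMeasure, integral_withDensity_eq_integral_toReal_smul (measurable_exp_neg hH)]
  · rfl
  · exact ae_of_all _ fun x => (exp_neg_le_one H x).trans_lt ENNReal.one_lt_top

instance isFiniteMeasure_expMeasure (H : UnitAddCircle → ℝ≥0∞) :
    IsFiniteMeasure (expMeasure H) := by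
  refine isFiniteMeasure_withDensity (ne_top_of_le_ne_top (b := ∫⁻ _ : UnitAddCircle, 1) ?_
    (lintegral_mono (exp_neg_le_one H)))
  simp

theorem integrable_weight_mul {H : UnitAddCircle → ℝ≥0∞} (hH : Measurable H)
    {f : UnitAddCircle → ℝ} (hf : Continuous f) : Integrable fun x => weight H x * f x := by
  refine (integrable_of_continuous hf).bdd_mul (c := 1) (measurable_weight hH).aestronglyMeasurable
    (ae_of_all _ fun x => ?_)
  rw [Real.norm_eq_abs, abs_of_nonneg (weight_nonneg H x)]
  exact weight_le_one H x

/-- The integral of `H` over the set where `H ≤ a`. -/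
noncomputable def truncIntegral (H : UnitAddCircle → ℝ≥0∞) (a : ℝ) : ℝ :=
  ∫ x in {x | ENNReal.ofReal a < H x}ᶜ, (H x).toReal

theorem toReal_le_of_not_lt {a : ℝ} (ha : 0 ≤ a) {t : ℝ≥0∞} (h : ¬ ENNReal.ofReal a < t) :
    t.toReal ≤ a :=
  ENNReal.toReal_le_of_le_ofReal ha (not_lt.1 h)

theorem ne_top_of_not_lt {a : ℝ} {t : ℝ≥0∞} (h : ¬ ENNReal.ofReal a < t) : t ≠ ∞ :=
  ne_top_of_le_ne_top ENNReal.ofReal_ne_top (not_lt.1 h)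

theorem measurableSet_superlevel {H : UnitAddCircle → ℝ≥0∞} (hH : Measurable H) (a : ℝ) :
    MeasurableSet {x | ENNReal.ofReal a < H x} :=
  measurableSet_lt measurable_const hH

theorem integrableOn_toReal {H : UnitAddCircle → ℝ≥0∞} (hH : Measurable H) {a : ℝ} (ha : 0 ≤ a) :
    IntegrableOn (fun x => (H x).toReal) {x | ENNReal.ofReal a < H x}ᶜ := by
  refine Measure.integrableOn_of_bounded (M := a) (measure_ne_top _ _)
    hH.ennreal_toReal.aestronglyMeasurable ?_
  refine (ae_restrict_iff' (measurableSet_superlevel hH a).compl).2 (ae_of_all _ fun x hx => ?_)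
  rw [Real.norm_eq_abs, abs_of_nonneg ENNReal.toReal_nonneg]
  exact toReal_le_of_not_lt ha hx

theorem truncIntegral_nonneg (H : UnitAddCircle → ℝ≥0∞) (a : ℝ) : 0 ≤ truncIntegral H a :=
  integral_nonneg fun _ => ENNReal.toReal_nonneg

theorem distrib_le_one (H : UnitAddCircle → ℝ≥0∞) (a : ℝ) : distrib H a ≤ 1 := by
  rw [← volume_real_univ]
  exact measureReal_mono (Set.subset_univ _)

theorem volume_real_compl_superlevel {H : UnitAddCircle → ℝ≥0∞} (hH : Measurable H) (a : ℝ) :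
    volume.real {x | ENNReal.ofReal a < H x}ᶜ = 1 - distrib H a := by
  rw [measureReal_compl (measurableSet_superlevel hH a), volume_real_univ]; rfl

/-- Split `0 ≤ ∫ U` over `F` and its complement. On `F` use the uniform bound for `U`; off `F`
integrate `U ≤ H - T + e^{T-H+U}`, whose exponential term contributes at most `1` by assumption. -/
theorem mul_le_of_exp_mul_integral_le_one {H : UnitAddCircle → ℝ≥0∞} (hH : Measurable H)
    {n : ℕ} {A κ : ℝ} (hκ : distrib H A ≤ κ) (hκ1 : κ < 1) (hpos : 0 < distrib H A)
    (hA : n * distrib H A = A) (hA1 : 1 ≤ A * distrib H A)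
    {s : Multiset ℂ} (hs : ∀ a ∈ s, ‖a‖ ≠ 1) (hn : s.card = n) {T : ℝ} (hT : 0 ≤ T)
    (hI : Real.exp T * ∫ x, ‖(s.map ((AddCircle.toCircle x : ℂ) - ·)).prod‖ ^ 2 ∂(expMeasure H)
      ≤ 1) :
    T * (1 - κ) ≤ 20 * (A * distrib H A) / (1 - κ) + truncIntegral H A + 1 := by
  set F := {x | ENNReal.ofReal A < H x} with hFdef
  have hF : MeasurableSet F := measurableSet_superlevel hH A
  have hlF : volume.real F = distrib H A := rfl
  set U : UnitAddCircle → ℝ := fun x =>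
    2 * Real.log ‖(s.map ((AddCircle.toCircle x : ℂ) - ·)).prod‖ with hUdef
  have hU : Continuous U := continuous_const.mul (continuous_log_norm_prod_sub hs)
  have hexp : ∀ x, ‖(s.map ((AddCircle.toCircle x : ℂ) - ·)).prod‖ ^ 2 = Real.exp (U x) := by
    intro x
    have := norm_pos_iff.2 (prod_sub_ne_zero hs (norm_toCircle x))
    rw [hUdef]
    simp only
    rw [two_mul, Real.exp_add, Real.exp_log this, sq]
  simp_rw [hexp] at hI
  rw [integral_expMeasure hH] at hI
  have hUe : Continuous fun x => Real.exp (U x) := Real.continuous_exp.comp hU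
  have hwi := integrable_weight_mul hH hUe
  have hA0 : 0 ≤ A := hA ▸ by positivity
  have hI0 : ∀ x, 0 ≤ weight H x * Real.exp (U x) := fun x =>
    mul_nonneg (weight_nonneg H x) (Real.exp_pos _).le
  have hw : ∀ x ∈ Fᶜ, weight H x = Real.exp (-(H x).toReal) := fun x hx =>
    weight_of_ne_top (ne_top_of_not_lt hx)
  have hE : ∫ x in Fᶜ, Real.exp (U x) ≤ Real.exp A := by
    calc ∫ x in Fᶜ, Real.exp (U x)
        ≤ ∫ x in Fᶜ, Real.exp A * (weight H x * Real.exp (U x)) := by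
          refine setIntegral_mono_on (integrable_of_continuous hUe).integrableOn
            (hwi.const_mul _).integrableOn hF.compl fun x hx => ?_
          rw [hw x hx, ← mul_assoc, ← Real.exp_add]
          refine le_mul_of_one_le_left (Real.exp_pos _).le (Real.one_le_exp ?_)
          linarith [toReal_le_of_not_lt hA0 hx]
      _ = Real.exp A * ∫ x in Fᶜ, weight H x * Real.exp (U x) := integral_const_mul _ _
      _ ≤ Real.exp A * ∫ x, weight H x * Real.exp (U x) :=
          mul_le_mul_of_nonneg_left (setIntegral_le_integral hwi (ae_of_all _ hI0))
            (Real.exp_pos _).le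
      _ ≤ Real.exp A * 1 := by
          refine mul_le_mul_of_nonneg_left (le_trans ?_ hI) (Real.exp_pos _).le
          exact le_mul_of_one_le_left (integral_nonneg hI0) (Real.one_le_exp hT)
      _ = Real.exp A := mul_one _
  have h0 : 0 ≤ ∫ x, U x := by
    rw [hUdef, integral_const_mul]
    exact mul_nonneg zero_le_two (integral_log_norm_prod_sub_nonneg s hs)
  have hsup := le_of_le_integral_poisson hU (n := n) (fun x r hr0 hr1 => ?_) h0 hF hκ hκ1 hpos hA
    hA1 hE
  · rw [← integral_add_compl hF (integrable_of_continuous hU)] at h0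
    have h1 : ∫ x in F, U x ≤ 20 * A / (1 - κ) * distrib H A := by
      refine (setIntegral_mono (integrable_of_continuous hU).integrableOn
        (integrable_const (20 * A / (1 - κ))).integrableOn hsup).trans_eq ?_
      rw [setIntegral_const, smul_eq_mul, hlF, mul_comm]
    have hTi : IntegrableOn (fun _ : UnitAddCircle => T) Fᶜ := (integrable_const T).integrableOn
    have hsub : IntegrableOn (fun x => (H x).toReal - T) Fᶜ := (integrableOn_toReal hH hA0).sub hTi
    have h2 : ∫ x in Fᶜ, U x ≤ truncIntegral H A - T * (1 - distrib H A) + 1 := by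
      calc ∫ x in Fᶜ, U x
          ≤ ∫ x in Fᶜ, ((H x).toReal - T + Real.exp T * (weight H x * Real.exp (U x))) := by
            refine setIntegral_mono_on (integrable_of_continuous hU).integrableOn
              (hsub.add (hwi.const_mul _).integrableOn) hF.compl fun x hx => ?_
            rw [hw x hx, ← Real.exp_add, ← Real.exp_add]
            linarith [Real.add_one_le_exp (T + (-(H x).toReal + U x))]
        _ = truncIntegral H A - T * (1 - distrib H A)
              + Real.exp T * ∫ x in Fᶜ, weight H x * Real.exp (U x) := by
            rw [integral_add hsub (hwi.const_mul _).integrableOn,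
                integral_sub (integrableOn_toReal hH hA0) hTi, setIntegral_const, integral_const_mul,
                volume_real_compl_superlevel hH, smul_eq_mul, mul_comm T]
            rfl
        _ ≤ _ := by
            have := mul_le_mul_of_nonneg_left
              (setIntegral_le_integral (s := Fᶜ) hwi (ae_of_all _ hI0)) (Real.exp_pos T).le
            linarith
    have h3 : 20 * (A * distrib H A) / (1 - κ) = 20 * A / (1 - κ) * distrib H A := by ring
    have h4 : T * (1 - κ) ≤ T * (1 - distrib H A) := mul_le_mul_of_nonneg_left (by linarith) hT
    linarith
  · have := log_norm_prod_sub_le_integral_poisson (norm_toCircle x) hr0 hr1 s hs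
    rw [hn] at this
    have e : ∀ y, poisson (r * AddCircle.toCircle x) y * U y =
      2 * (poisson (r * AddCircle.toCircle x) y *
        Real.log ‖(s.map ((AddCircle.toCircle y : ℂ) - ·)).prod‖) := fun y => by
      rw [hUdef]; ring
    simp_rw [e]
    rw [integral_const_mul, hUdef]
    simp only
    linarith

/-! ### From zeros off the circle to all monic polynomials. -/

theorem continuous_integral_prod_sub (ρ : Measure UnitAddCircle) [IsFiniteMeasure ρ]
    (s : Multiset ℂ) : Continuous fun t : ℝ =>
      ∫ x, ‖((s.map fun a : ℂ => (t : ℂ) * a).map ((AddCircle.toCircle x : ℂ) - ·)).prod‖ ^ 2 ∂ρ := by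
  have := continuous_parametric_integral_of_continuous (μ := ρ) (s := Set.univ)
    (f := fun (t : ℝ) (x : UnitAddCircle) =>
      ‖((s.map fun a : ℂ => (t : ℂ) * a).map ((AddCircle.toCircle x : ℂ) - ·)).prod‖ ^ 2) ?_ isCompact_univ
  · simpa only [setIntegral_univ] using this
  · simp only [Multiset.map_map, Function.comp_def, Function.uncurry_def]
    refine (continuous_multiset_prod s fun a _ => ?_).norm.pow 2
    have := continuous_toCircle
    fun_prop

/-- Scaling all zeros by `t` slightly above `1` moves them off the circle. The integrals depend
continuously on `t`, so the lower bound survives the limit `t → 1`. -/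
theorem eventually_norm_mul_ne_one (s : Multiset ℂ) :
    ∀ᶠ t : ℝ in 𝓝[>] 1, ∀ a ∈ s.map fun a : ℂ => (t : ℂ) * a, ‖a‖ ≠ 1 := by
  have h : ∀ a ∈ s.toFinset, ∀ᶠ t : ℝ in 𝓝[>] 1, ‖(t : ℂ) * a‖ ≠ 1 := by
    intro a _
    by_cases ha : ‖a‖ = 1
    · filter_upwards [self_mem_nhdsWithin] with t ht
      have ht : 1 < t := ht
      rw [norm_mul, ha, Complex.norm_real, Real.norm_eq_abs, abs_of_pos (by linarith)]
      linarith
    · have hc : ContinuousAt (fun t : ℝ => ‖(t : ℂ) * a‖) 1 := by fun_prop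
      exact (hc.eventually_ne (by simpa using ha)).filter_mono nhdsWithin_le_nhds
  filter_upwards [(Finset.eventually_all s.toFinset).2 h] with t ht a ha
  obtain ⟨b, hb, rfl⟩ := Multiset.mem_map.1 ha
  exact ht b (Multiset.mem_toFinset.2 hb)

theorem exists_roots_of_monic_sum {n : ℕ} (q : Fin n → ℂ) : ∃ s : Multiset ℂ, s.card = n ∧
    ∀ z : ℂ, ∑ j : Fin n, q j * z ^ (j : ℕ) + z ^ n = (s.map (z - ·)).prod := by
  set p : Polynomial ℂ :=
    Polynomial.X ^ n + ∑ j : Fin n, Polynomial.C (q j) * Polynomial.X ^ (j : ℕ) with hp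
  have hd := Polynomial.degree_sum_fin_lt q
  have hm : p.Monic := Polynomial.monic_X_pow_add hd
  have hs : p.Splits := IsAlgClosed.splits p
  refine ⟨p.roots, ?_, fun z => ?_⟩
  · rw [← hs.natDegree_eq_card_roots]
    refine Polynomial.natDegree_eq_of_degree_eq_some ?_
    rw [hp, Polynomial.degree_add_eq_left_of_degree_lt] <;> rw [Polynomial.degree_X_pow]
    exact hd
  · rw [← hs.eval_eq_prod_roots_of_monic hm, hp]
    simp [Polynomial.eval_finsetSum, add_comm]

theorem exp_neg_le_predErr {H : UnitAddCircle → ℝ≥0∞} (hH : Measurable H)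
    {n : ℕ} {A κ : ℝ} (hκ : distrib H A ≤ κ) (hκ1 : κ < 1) (hpos : 0 < distrib H A)
    (hA : n * distrib H A = A) (hA1 : 1 ≤ A * distrib H A) {B : ℝ}
    (hB : 20 * (A * distrib H A) / (1 - κ) + truncIntegral H A + 1 ≤ B * (1 - κ)) :
    Real.exp (-B) ≤ predErr (expMeasure H) n := by
  have hk : 0 < 1 - κ := by linarith
  have hB0 : 0 ≤ B := by
    have := truncIntegral_nonneg H A
    have : 0 ≤ 20 * (A * distrib H A) / (1 - κ) := by positivity
    exact (pos_of_mul_pos_left (by linarith : 0 < B * (1 - κ)) hk.le).le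
  have key : ∀ s : Multiset ℂ, s.card = n → (∀ a ∈ s, ‖a‖ ≠ 1) → Real.exp (-B) ≤
      ∫ x, ‖(s.map ((AddCircle.toCircle x : ℂ) - ·)).prod‖ ^ 2 ∂(expMeasure H) := by
    intro s hn hs
    by_contra! hlt
    set I := ∫ x, ‖(s.map ((AddCircle.toCircle x : ℂ) - ·)).prod‖ ^ 2 ∂(expMeasure H) with hI
    -- A strictly larger `T` is needed, because the resulting bound on `T * (1 - κ)` is not strict
    -- and `T = B` would give no contradiction.
    have hT : ∃ T, B < T ∧ Real.exp T * I ≤ 1 := by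
      have hc : ContinuousAt (fun T => Real.exp T * I) B := by fun_prop
      have h1 : Real.exp B * I < 1 := by
        have := mul_lt_mul_of_pos_left hlt (Real.exp_pos B)
        rwa [← Real.exp_add, add_neg_cancel, Real.exp_zero] at this
      have h2 : ∀ᶠ T in 𝓝[>] B, Real.exp T * I < 1 :=
        (hc.eventually_lt_const h1).filter_mono nhdsWithin_le_nhds
      obtain ⟨T, hT, hT'⟩ := (h2.and self_mem_nhdsWithin).exists
      exact ⟨T, hT', hT.le⟩
    obtain ⟨T, hBT, hT⟩ := hT
    have := mul_le_of_exp_mul_integral_le_one hH hκ hκ1 hpos hA hA1 hs hn (hB0.trans hBT.le) hT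
    have := mul_lt_mul_of_pos_right hBT hk
    linarith
  refine le_ciInf fun q => ?_
  obtain ⟨s, hn, hs⟩ := exists_roots_of_monic_sum q
  simp_rw [hs]
  have hle : Real.exp (-B) ≤
      ∫ x, ‖(s.map ((AddCircle.toCircle x : ℂ) - ·)).prod‖ ^ 2 ∂(expMeasure H) := by
    have hlim := ((continuous_integral_prod_sub (expMeasure H) s).tendsto 1).mono_left
      (nhdsWithin_le_nhds (s := Set.Ioi 1))
    have := ge_of_tendsto hlim ((eventually_norm_mul_ne_one s).mono fun t ht =>
      key _ (by rw [Multiset.card_map, hn]) ht)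
    simpa using this
  -- The square root would even give `e^{-B/2}`; since `B ≥ 0`, the weaker `e^{-B}` suffices.
  refine Real.le_sqrt_of_sq_le (le_trans ?_ hle)
  rw [sq, ← Real.exp_add, Real.exp_le_exp]
  linarith

/-! ### Growth of the distribution function under the doubling condition. -/

variable {H : UnitAddCircle → ℝ≥0∞}

theorem distrib_anti (H : UnitAddCircle → ℝ≥0∞) : Antitone (distrib H) := fun _ _ hab =>
  measureReal_mono fun _ hx => (ENNReal.ofReal_le_ofReal hab).trans_lt hx

theorem distrib_pos (hI : ∫⁻ x, H x = ∞) (a : ℝ) : 0 < distrib H a := by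
  by_contra! h
  have h0 : volume {x | ENNReal.ofReal a < H x} = 0 :=
    (measureReal_eq_zero_iff).1 (le_antisymm h measureReal_nonneg)
  have h1 : ∀ᵐ x, H x ≤ ENNReal.ofReal a := by
    rw [ae_iff]; simpa only [not_le] using h0
  have h2 := lintegral_mono_ae h1
  rw [hI, lintegral_const] at h2
  exact absurd h2 (not_le.2 (ENNReal.mul_lt_top ENNReal.ofReal_lt_top (measure_lt_top _ _)))

theorem eventually_distrib_le (hH : Measurable H) {κ κ' : ℝ}
    (h : volume.real {x | H x = ∞} ≤ κ) (hκ : κ < κ') : ∀ᶠ a in atTop, distrib H a ≤ κ' := by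
  have hS : {x | H x = ∞} = ⋂ n : ℕ, {x | ENNReal.ofReal n < H x} := by
    ext x
    simp only [Set.mem_ofPred_eq, Set.mem_iInter, ENNReal.ofReal_natCast]
    refine ⟨fun h n => h ▸ ENNReal.natCast_lt_top n, fun h => ?_⟩
    by_contra hx
    obtain ⟨n, hn⟩ := ENNReal.exists_nat_gt hx
    exact lt_asymm hn (h n)
  have ht := tendsto_measure_iInter_atTop (μ := (volume : Measure UnitAddCircle))
    (s := fun n : ℕ => {x | ENNReal.ofReal n < H x})
    (fun n => (measurableSet_superlevel hH n).nullMeasurableSet)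
    (fun m n hmn x hx => (ENNReal.ofReal_le_ofReal (Nat.cast_le.2 hmn)).trans_lt hx)
    ⟨0, measure_ne_top _ _⟩
  rw [← hS] at ht
  have ht' := (ENNReal.tendsto_toReal (measure_ne_top volume {x | H x = ∞})).comp ht
  obtain ⟨N, hN⟩ := (ht'.eventually_lt_const (h.trans_lt hκ)).exists
  filter_upwards [eventually_ge_atTop (N : ℝ)] with a ha
  exact (distrib_anti H ha).trans hN.le

theorem eventually_distrib_le_mul_distrib_two_mul (hI : ∫⁻ x, H x = ∞) {q : ℝ≥0∞} {p : ℝ}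
    (hq : limsup (fun a : ℝ => ENNReal.ofReal (distrib H a / distrib H (2 * a))) atTop ≤ q)
    (hp : q < ENNReal.ofReal p) : ∀ᶠ a in atTop, distrib H a ≤ p * distrib H (2 * a) := by
  filter_upwards [eventually_lt_of_limsup_lt (hq.trans_lt hp)] with a ha
  have hpos := distrib_pos hI (2 * a)
  have hp0 : 0 < p := ENNReal.ofReal_pos.1 (bot_le.trans_lt ha)
  rw [ENNReal.ofReal_lt_ofReal_iff hp0, div_lt_iff₀ hpos] at ha
  exact ha.le

theorem dyadic_induction {P : ℝ → Prop} {a₀ : ℝ} (h0 : 0 < a₀)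
    (hbase : ∀ a, a₀ ≤ a → a ≤ 2 * a₀ → P a) (hstep : ∀ a, a₀ ≤ a → P a → P (2 * a)) {a : ℝ}
    (ha : a₀ ≤ a) : P a := by
  have key : ∀ k : ℕ, ∀ a, a₀ ≤ a → a ≤ 2 ^ (k + 1) * a₀ → P a := by
    intro k
    induction k with
    | zero => intro a h1 h2; exact hbase a h1 (by simpa using h2)
    | succ k ih =>
      intro a h1 h2
      rcases le_total a (2 * a₀) with h | h
      · exact hbase a h1 h
      · have := hstep (a / 2) (by linarith) (ih (a / 2) (by linarith) (by
          rw [pow_succ] at h2; linarith))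
        rwa [mul_div_cancel₀ a two_ne_zero] at this
  obtain ⟨k, hk⟩ := pow_unbounded_of_one_lt (a / a₀) one_lt_two
  refine key k a ha ?_
  rw [div_lt_iff₀ h0] at hk
  rw [pow_succ]
  linarith

/-- Each doubling of `a` multiplies `a * distrib H a` by at least `2 / p > 1`. -/
theorem tendsto_mul_distrib (hI : ∫⁻ x, H x = ∞) {p : ℝ} (hp0 : 0 < p) (hp2 : p < 2)
    (hp : ∀ᶠ a in atTop, distrib H a ≤ p * distrib H (2 * a)) :
    Tendsto (fun a => a * distrib H a) atTop atTop := by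
  obtain ⟨b, hb⟩ := eventually_atTop.1 hp
  set a₀ := max b 1
  have h0 : 0 < a₀ := lt_max_of_lt_right one_pos
  have hd : ∀ a, a₀ ≤ a → distrib H a ≤ p * distrib H (2 * a) := fun a ha =>
    hb a ((le_max_left _ _).trans ha)
  have hr : 1 < 2 / p := (one_lt_div hp0).2 hp2
  set m := a₀ * distrib H (2 * a₀)
  have hm : 0 < m := mul_pos h0 (distrib_pos hI _)
  have hgrow : ∀ a, a₀ ≤ a → 2 / p * (a * distrib H a) ≤ 2 * a * distrib H (2 * a) := by
    intro a ha
    rw [div_mul_eq_mul_div, div_le_iff₀ hp0]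
    have := mul_le_mul_of_nonneg_left (hd a ha) (by linarith : 0 ≤ 2 * a)
    linarith
  have hbase : ∀ a, a₀ ≤ a → m ≤ a * distrib H a := fun a ha =>
    dyadic_induction (P := fun a => m ≤ a * distrib H a) h0
      (fun a h1 h2 => mul_le_mul h1 (distrib_anti H h2) measureReal_nonneg (by linarith))
      (fun a h1 h2 => by
        refine h2.trans (le_trans ?_ (hgrow a h1))
        exact le_mul_of_one_le_left (hm.le.trans h2) hr.le) ha
  have hpow : ∀ k : ℕ, ∀ a, 2 ^ k * a₀ ≤ a → (2 / p) ^ k * m ≤ a * distrib H a := by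
    intro k
    induction k with
    | zero => intro a ha; simpa using hbase a (by simpa using ha)
    | succ k ih =>
      intro a ha
      have h1 : 2 ^ k * a₀ ≤ a / 2 := by rw [pow_succ] at ha; linarith
      have h2 : a₀ ≤ a / 2 := le_trans (le_mul_of_one_le_left h0.le (one_le_pow₀ one_le_two)) h1
      have h3 := hgrow (a / 2) h2
      rw [mul_div_cancel₀ a two_ne_zero] at h3
      refine le_trans ?_ h3
      rw [pow_succ', mul_assoc]
      exact mul_le_mul_of_nonneg_left (ih _ h1) (by positivity)
  refine tendsto_atTop.2 fun M => ?_
  obtain ⟨k, hk⟩ := pow_unbounded_of_one_lt (M / m) hr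
  rw [div_lt_iff₀ hm] at hk
  filter_upwards [eventually_ge_atTop (2 ^ k * a₀)] with a ha
  exact hk.le.trans (hpow k a ha)

theorem truncIntegral_le (hH : Measurable H) {a : ℝ} (ha : 0 ≤ a) : truncIntegral H a ≤ a := by
  refine (setIntegral_mono_on (integrableOn_toReal hH ha) (integrable_const a).integrableOn
    (measurableSet_superlevel hH a).compl fun x hx => toReal_le_of_not_lt ha hx).trans ?_
  rw [setIntegral_const, volume_real_compl_superlevel hH, smul_eq_mul]
  exact mul_le_of_le_one_left ha (sub_le_self _ measureReal_nonneg)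

theorem truncIntegral_two_mul_le (hH : Measurable H) {a : ℝ} (ha : 0 ≤ a) :
    truncIntegral H (2 * a) ≤ truncIntegral H a + 2 * a * distrib H a := by
  have h2a : 0 ≤ 2 * a := by linarith
  have hm := (measurableSet_superlevel hH a).compl
  have hint := integrableOn_toReal hH h2a
  have hsub : {x | ENNReal.ofReal a < H x}ᶜ ⊆ {x | ENNReal.ofReal (2 * a) < H x}ᶜ :=
    Set.compl_subset_compl.2 fun x hx =>
      (ENNReal.ofReal_le_ofReal (by linarith : a ≤ 2 * a)).trans_lt hx
  rw [truncIntegral, ← integral_inter_add_sdiff hm hint, Set.inter_eq_right.2 hsub]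
  refine add_le_add le_rfl ?_
  refine (setIntegral_mono_on (hint.mono_set Set.sdiff_subset)
    (integrable_const (2 * a)).integrableOn
    ((measurableSet_superlevel hH (2 * a)).compl.diff hm)
    fun x hx => toReal_le_of_not_lt h2a hx.1).trans ?_
  rw [setIntegral_const, smul_eq_mul, mul_comm]
  exact mul_le_mul_of_nonneg_left (measureReal_mono fun x hx => not_not.1 hx.2) h2a

/-- Passing from `a` to `2a` adds at most `2a * distrib H a`. The constant `C = 2p/(2 - p)` is the
fixed point of `C = p(C + 2)/2`, so the induction over doublings closes exactly. -/
theorem exists_truncIntegral_le (hH : Measurable H) {p : ℝ} (hp0 : 0 < p) (hp2 : p < 2)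
    (hp : ∀ᶠ a in atTop, distrib H a ≤ p * distrib H (2 * a)) :
    ∃ D, ∀ᶠ a in atTop, truncIntegral H a ≤ D + 2 * p / (2 - p) * (a * distrib H a) := by
  obtain ⟨b, hb⟩ := eventually_atTop.1 hp
  set a₀ := max b 1
  have h0 : 0 < a₀ := lt_max_of_lt_right one_pos
  have hC : 0 ≤ 2 * p / (2 - p) := div_nonneg (by linarith) (by linarith)
  refine ⟨2 * a₀, (eventually_ge_atTop a₀).mono fun a ha => dyadic_induction
    (P := fun a => truncIntegral H a ≤ 2 * a₀ + 2 * p / (2 - p) * (a * distrib H a)) h0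
    (fun a h1 h2 => ?_) (fun a h1 h2 => ?_) ha⟩
  · have : 0 ≤ a * distrib H a := mul_nonneg (h0.le.trans h1) measureReal_nonneg
    have := mul_nonneg hC this
    linarith [truncIntegral_le hH (h0.le.trans h1)]
  · have hd := hb a ((le_max_left _ _).trans h1)
    have h3 := truncIntegral_two_mul_le hH (h0.le.trans h1)
    have h4 : (2 * p / (2 - p) + 2) * (a * distrib H a)
        ≤ (2 * p / (2 - p) + 2) * (a * (p * distrib H (2 * a))) :=
      mul_le_mul_of_nonneg_left (mul_le_mul_of_nonneg_left hd (h0.le.trans h1)) (by linarith)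
    have h5 : (2 * p / (2 - p) + 2) * (a * (p * distrib H (2 * a)))
        = 2 * p / (2 - p) * (2 * a * distrib H (2 * a)) := by
      have : 2 - p ≠ 0 := by linarith
      field_simp; ring
    linarith

/-- This turns properties valid for large levels into properties valid for large `n`: a solution `A
< a` would satisfy `A ≥ n * distrib H a`, which is impossible for large `n`. -/
theorem exists_forall_le_of_mul_distrib_eq (hI : ∫⁻ x, H x = ∞) (a : ℝ) :
    ∃ n₀ : ℕ, ∀ n : ℕ, n₀ ≤ n → ∀ A : ℝ, n * distrib H A = A → a ≤ A := by
  have hpos := distrib_pos hI a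
  obtain ⟨n₀, h⟩ := exists_nat_ge (a / distrib H a)
  refine ⟨n₀, fun n hn A hA => ?_⟩
  by_contra! hlt
  rw [div_le_iff₀ hpos] at h
  have h1 : (n₀ : ℝ) * distrib H a ≤ n * distrib H A :=
    mul_le_mul (Nat.cast_le.2 hn) (distrib_anti H hlt.le) hpos.le n.cast_nonneg
  linarith

/-! ### Test polynomials concentrated on an arc. -/

theorem exists_arc_of_lt_longestArc {a l : ℝ} (h : l < longestArc H a) : ∃ α : ℝ,
    ∀ θ ∈ Set.Ioo α (α + l), ENNReal.ofReal a < H (θ : UnitAddCircle) := by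
  obtain ⟨l', ⟨-, -, α, hα⟩, hl⟩ := exists_lt_of_lt_csSup
    (s := {l : ℝ | 0 ≤ l ∧ l ≤ 1 ∧ ∃ α : ℝ, ∀ θ ∈ Set.Ioo α (α + l),
      ENNReal.ofReal a < H (θ : UnitAddCircle)})
    ⟨0, le_rfl, zero_le_one, 0, fun θ hθ => absurd hθ (by simp)⟩ h
  exact ⟨α, fun θ hθ => hα θ ⟨hθ.1, hθ.2.trans (by linarith)⟩⟩

/-- Cauchy's estimates on the circle of radius `R` dominate the Taylor tail on the unit circle by a
geometric series. -/
theorem exists_taylor_approx {f : ℂ → ℂ} {R M : ℝ} (hR : 1 < R)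
    (hf : DiffContOnCl ℂ f (Metric.ball 0 R)) (hM : ∀ z, ‖z‖ ≤ R → ‖f z‖ ≤ M) (n : ℕ) :
    ∃ a : ℕ → ℂ, a 0 = f 0 ∧ ∀ z : ℂ, ‖z‖ = 1 →
      ‖∑ k ∈ Finset.range n, a k * z ^ k - f z‖ ≤ M * R⁻¹ ^ n / (1 - R⁻¹) := by
  have hR0 : 0 < R := by linarith
  refine ⟨fun k => (k.factorial : ℂ)⁻¹ * iteratedDeriv k f 0, by simp, fun z hz => ?_⟩
  have hs := Complex.hasSum_taylorSeries_on_ball (c := 0) (z := z) hf.differentiableOn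
    (by simpa [hz] using hR)
  refine norm_sub_le_of_geometric_bound_of_hasSum (inv_lt_one_of_one_lt₀ hR) (fun k => ?_)
    (by simpa [mul_comm, mul_left_comm, mul_assoc] using hs) n
  have hb := Complex.norm_iteratedDeriv_le_of_forall_mem_sphere_norm_le k hR0 hf
    fun w hw => hM w (by simpa using (mem_sphere_zero_iff_norm.1 hw).le)
  have hk : (0 : ℝ) < k.factorial := by positivity
  rw [norm_mul, norm_mul, norm_pow, hz, one_pow, mul_one, norm_inv, Complex.norm_natCast,
    inv_mul_le_iff₀ hk]
  refine hb.trans_eq ?_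
  rw [inv_pow]; ring

/-- A function analytic in a neighbourhood of the closed unit disc, whose real part is nonpositive
on the unit circle away from an arc about `1` of half-width comparable to `h`. -/
noncomputable def arcFun (h : ℝ) (z : ℂ) : ℂ :=
  ((1 - (1 - h) ^ 2 : ℝ) : ℂ) / 4 * (2 * (1 - (1 - h : ℝ) * z)⁻¹ - 1) +
    ((1 - (1 - h) ^ 2 : ℝ) : ℂ) ^ 2 * ((1 - (1 - h : ℝ) * z)⁻¹ ^ 2 - 1 / 2)

theorem le_norm_one_sub {h : ℝ} (h0 : 0 < h) (h1 : h ≤ 1 / 4) {z : ℂ} (hz : ‖z‖ ≤ 1 + h / 2) :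
    h / 2 ≤ ‖1 - (1 - h : ℝ) * z‖ := by
  have e : ‖((1 - h : ℝ) : ℂ) * z‖ ≤ (1 - h) * (1 + h / 2) := by
    rw [norm_mul, Complex.norm_real, Real.norm_eq_abs, abs_of_nonneg (by linarith)]
    exact mul_le_mul_of_nonneg_left hz (by linarith)
  have := norm_sub_norm_le (1 : ℂ) ((1 - h : ℝ) * z)
  rw [norm_one] at this
  nlinarith

/-- The pole `1 / (1 - h)` stays at distance of order `h` from this disc, and the factor `p = 1 - (1
- h)²`, also of order `h`, compensates each power of `W`. The bound is thus independent of `h`. -/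
theorem norm_arcFun_le {h : ℝ} (h0 : 0 < h) (h1 : h ≤ 1 / 4) {z : ℂ} (hz : ‖z‖ ≤ 1 + h / 2) :
    ‖arcFun h z‖ ≤ 19 := by
  have hd := le_norm_one_sub h0 h1 hz
  set W := (1 - ((1 - h : ℝ) : ℂ) * z)⁻¹ with hW
  have hWn : ‖W‖ ≤ 2 / h := by
    rw [hW, norm_inv, ← inv_div]
    exact inv_anti₀ (by positivity) hd
  set p : ℝ := 1 - (1 - h) ^ 2 with hp
  have hp0 : 0 ≤ p := by nlinarith
  have hp1 : p ≤ 2 * h := by nlinarith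
  have hpW : p * ‖W‖ ≤ 4 := by
    calc p * ‖W‖ ≤ 2 * h * (2 / h) := mul_le_mul hp1 hWn (norm_nonneg _) (by positivity)
      _ = 4 := by field_simp; norm_num
  have hpn : ‖(p : ℂ)‖ = p := by rw [Complex.norm_real, Real.norm_eq_abs, abs_of_nonneg hp0]
  have b1 : ‖(p : ℂ) / 4 * (2 * W - 1)‖ ≤ p / 4 * (2 * ‖W‖ + 1) := by
    rw [norm_mul, norm_div, hpn, Complex.norm_ofNat]
    refine mul_le_mul_of_nonneg_left ((norm_sub_le _ _).trans_eq ?_) (by positivity)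
    simp
  have b2 : ‖(p : ℂ) ^ 2 * (W ^ 2 - 1 / 2)‖ ≤ p ^ 2 * (‖W‖ ^ 2 + 1 / 2) := by
    rw [norm_mul, norm_pow, hpn]
    refine mul_le_mul_of_nonneg_left ((norm_sub_le _ _).trans_eq ?_) (by positivity)
    simp
  have b3 : p ^ 2 * ‖W‖ ^ 2 ≤ 16 := by
    rw [← mul_pow]; nlinarith [mul_nonneg hp0 (norm_nonneg W)]
  refine (norm_add_le _ _).trans ((add_le_add b1 b2).trans ?_)
  nlinarith

theorem arcFun_zero_re {h : ℝ} (h0 : 0 < h) (h1 : h ≤ 1 / 4) : h / 4 ≤ (arcFun h 0).re := by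
  have e : arcFun h 0 = (((1 - (1 - h) ^ 2) / 4 + (1 - (1 - h) ^ 2) ^ 2 / 2 : ℝ) : ℂ) := by
    simp only [arcFun]; push_cast; ring
  rw [e, Complex.ofReal_re]
  nlinarith [sq_nonneg (1 - (1 - h) ^ 2)]

/-- Put `p = 1 - (1 - h)²`. The first summand of `arcFun` is `p/4` times a function whose real part
is the Poisson kernel `p/D`. The second contributes `-p²(1 - h)²/D` and a term `p⁴/(2D²)` that
matters only near `1`; away from `1` the negative term outweighs the Poisson term. -/
theorem arcFun_re {h : ℝ} {z : ℂ} (hz : ‖z‖ = 1) {D : ℝ}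
    (hD : D = 1 + (1 - h) ^ 2 - 2 * (1 - h) * z.re) (hD0 : 0 < D) :
    (arcFun h z).re = (1 - (1 - h) ^ 2) ^ 2 / D *
      (1 / 4 - (1 - h) ^ 2 + (1 - (1 - h) ^ 2) ^ 2 / (2 * D)) := by
  have hn : z.re ^ 2 + z.im ^ 2 = 1 := by
    have := Complex.sq_norm z
    rw [hz, Complex.normSq_apply] at this; linarith
  set v : ℂ := 1 - ((1 - h : ℝ) : ℂ) * z with hv
  have hvr : v.re = 1 - (1 - h) * z.re := by simp [hv]
  have hvi : v.im = -((1 - h) * z.im) := by simp [hv]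
  have hvD : Complex.normSq v = D := by
    rw [Complex.normSq_apply, hvr, hvi, hD]
    linear_combination (1 - h) ^ 2 * hn
  have hre : (v⁻¹).re = v.re / D := by rw [Complex.inv_re, hvD]
  have him : (v⁻¹).im = -v.im / D := by rw [Complex.inv_im, hvD]
  have hi2 : v.im ^ 2 = D - v.re ^ 2 := by rw [← hvD, Complex.normSq_apply]; ring
  have hr2 : v.re = ((1 - (1 - h) ^ 2) + D) / 2 := by rw [hvr, hD]; ring
  have e2 : ((v⁻¹) ^ 2).re = (2 * v.re ^ 2 - D) / D ^ 2 := by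
    rw [sq, Complex.mul_re, hre, him]
    field_simp
    linear_combination -hi2
  have e : arcFun h z = ((1 - (1 - h) ^ 2) / 4 : ℝ) * (2 * v⁻¹ - 1) +
      (((1 - (1 - h) ^ 2) ^ 2 : ℝ) : ℂ) * ((v⁻¹) ^ 2 - (1 / 2 : ℝ)) := by
    rw [arcFun, hv]; push_cast; ring
  rw [e, Complex.add_re, Complex.re_ofReal_mul, Complex.re_ofReal_mul, Complex.sub_re,
    Complex.sub_re, e2, Complex.ofReal_re, Complex.one_re]
  have e3 : (2 * v⁻¹).re = 2 * (v⁻¹).re := by simp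
  rw [e3, hre, hr2]
  field_simp
  ring

/-- At distance at least `h` from the centre, `D ≥ 13h²` while `p² ≤ 4h²`, so `p²/(2D) ≤ 1/4`; and
`1/4 + 1/4 < 9/16 ≤ (1 - h)²`. -/
theorem arcFun_re_nonpos {h : ℝ} (h0 : 0 < h) (h1 : h ≤ 1 / 4) {t : ℝ} (ht : h ≤ |t|)
    (ht2 : |t| ≤ 1 / 2) :
    (arcFun h (Complex.exp ((2 * Real.pi * t : ℝ) * Complex.I))).re ≤ 0 := by
  set z := Complex.exp ((2 * Real.pi * t : ℝ) * Complex.I) with hz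
  have hzr : z.re = Real.cos (2 * Real.pi * t) := Complex.exp_ofReal_mul_I_re _
  have hc : 8 * h ^ 2 ≤ 1 - z.re := by
    have hsin : 2 * |t| ≤ Real.sin (Real.pi * |t|) := by
      have := Real.mul_le_sin (x := Real.pi * |t|) (by positivity) (by nlinarith [Real.pi_pos])
      have e : 2 / Real.pi * (Real.pi * |t|) = 2 * |t| := by field_simp
      linarith
    have e : z.re = 1 - 2 * Real.sin (Real.pi * |t|) ^ 2 := by
      rw [hzr, ← Real.cos_abs, abs_mul, abs_of_pos (by positivity : 0 < 2 * Real.pi), mul_assoc,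
        Real.cos_two_mul, Real.cos_sq']
      ring
    nlinarith
  set D := 1 + (1 - h) ^ 2 - 2 * (1 - h) * z.re with hD
  have hD1 : 13 * h ^ 2 ≤ D := by nlinarith
  have hD0 : 0 < D := by nlinarith
  rw [arcFun_re (Complex.norm_exp_ofReal_mul_I _) hD hD0]
  have hp : (1 - (1 - h) ^ 2) ^ 2 ≤ 4 * h ^ 2 := by
    have : (1 - (1 - h) ^ 2) ^ 2 = h ^ 2 * (2 - h) ^ 2 := by ring
    rw [this, mul_comm]
    exact mul_le_mul_of_nonneg_right (by nlinarith) (sq_nonneg h)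
  refine mul_nonpos_of_nonneg_of_nonpos (by positivity) ?_
  have : (1 - (1 - h) ^ 2) ^ 2 / (2 * D) ≤ 1 / 4 := by
    rw [div_le_div_iff₀ (by positivity) (by norm_num)]; nlinarith
  nlinarith

theorem diffContOnCl_exp_arcFun {h : ℝ} (h0 : 0 < h) (h1 : h ≤ 1 / 4) (B : ℝ) :
    DiffContOnCl ℂ (fun z => Complex.exp (B * arcFun h z)) (Metric.ball 0 (1 + h / 2)) := by
  refine DifferentiableOn.diffContOnCl fun z hz => ?_
  rw [closure_ball 0 (by positivity)] at hz
  have hd := le_norm_one_sub h0 h1 (by simpa using hz)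
  have hne : 1 - ((1 - h : ℝ) : ℂ) * z ≠ 0 := norm_pos_iff.1 (by linarith)
  have hi : DifferentiableAt ℂ (fun z : ℂ => (1 - ((1 - h : ℝ) : ℂ) * z)⁻¹) z :=
    DifferentiableAt.inv (by fun_prop) hne
  have : DifferentiableAt ℂ (arcFun h) z := by
    unfold arcFun
    fun_prop
  exact (this.const_mul _).cexp.differentiableWithinAt

/-- On the circle `t ^ n` times the conjugate of a polynomial of degree `n` is the reversed
polynomial, with the same modulus and leading coefficient `conj (a 0)`. A large value at the origin
thus becomes a small norm after normalization; `ω` rotates the arc into position. -/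
theorem norm_monic_of_conj {n : ℕ} (a : ℕ → ℂ) (ha : a 0 ≠ 0) {t ω : ℂ} (ht : ‖t‖ = 1)
    (hω : ‖ω‖ = 1) :
    ‖∑ j : Fin n, ((starRingEnd ℂ) (a (n - j)) * ω ^ (n - j : ℕ) / (starRingEnd ℂ) (a 0)) *
      t ^ (j : ℕ) + t ^ n‖ = ‖∑ k ∈ Finset.range (n + 1), a k * (t * ω⁻¹) ^ k‖ / ‖a 0‖ := by
  have ha' : (starRingEnd ℂ) (a 0) ≠ 0 := by simpa using ha
  have ht0 : t ≠ 0 := norm_ne_zero_iff.1 (by rw [ht]; exact one_ne_zero)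
  have hconj : ∀ w : ℂ, ‖w‖ = 1 → (starRingEnd ℂ) w = w⁻¹ := fun w hw => by
    rw [Complex.inv_def, Complex.normSq_eq_norm_sq, hw]; simp
  have e : ∑ j : Fin n, ((starRingEnd ℂ) (a (n - j)) * ω ^ (n - j : ℕ) / (starRingEnd ℂ) (a 0)) *
      t ^ (j : ℕ) + t ^ n = t ^ n / (starRingEnd ℂ) (a 0) *
        (starRingEnd ℂ) (∑ k ∈ Finset.range (n + 1), a k * (t * ω⁻¹) ^ k) := by
    have hterm : ∀ j ≤ n, (starRingEnd ℂ) (a (n - j)) * ω ^ (n - j) / (starRingEnd ℂ) (a 0) *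
        t ^ j = t ^ n / (starRingEnd ℂ) (a 0) *
          (starRingEnd ℂ) (a (n - j) * (t * ω⁻¹) ^ (n - j)) := by
      intro j hj
      have e3 : t ^ n = t ^ (n - j) * t ^ j := by rw [← pow_add, Nat.sub_add_cancel hj]
      have e4 : (starRingEnd ℂ) (t * ω⁻¹) = ω * t⁻¹ := by
        rw [hconj _ (by rw [norm_mul, norm_inv, ht, hω]; norm_num), mul_inv, inv_inv, mul_comm]
      rw [map_mul, map_pow, e4, e3, mul_pow, inv_pow]
      field_simp
    rw [Fin.sum_univ_eq_sum_range (fun j => ((starRingEnd ℂ) (a (n - j)) * ω ^ (n - j : ℕ) /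
      (starRingEnd ℂ) (a 0)) * t ^ j), map_sum, Finset.mul_sum,
      ← Finset.sum_range_reflect (n := n + 1), Finset.sum_range_succ]
    simp only [add_tsub_cancel_right]
    congr 1
    · exact Finset.sum_congr rfl fun j hj => hterm j (Finset.mem_range.1 hj).le
    · rw [← hterm n le_rfl]
      simp [ha']
  rw [e, norm_mul, norm_div, norm_pow, ht, one_pow, RCLike.norm_conj, RCLike.norm_conj]
  ring

theorem exists_abs_le_half_eq (β : ℝ) (x : UnitAddCircle) :
    ∃ t : ℝ, |t| ≤ 1 / 2 ∧ x = ((β + t : ℝ) : UnitAddCircle) := by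
  obtain ⟨y, rfl⟩ := QuotientAddGroup.mk_surjective x
  refine ⟨y - β - round (y - β), abs_sub_round _, ?_⟩
  rw [show β + (y - β - round (y - β)) = y - round (y - β) by ring]
  refine sub_eq_zero.1 (Eq.trans (AddCircle.coe_sub 1 y _).symm ?_)
  exact AddCircle.coe_eq_zero_iff 1 |>.2 ⟨round (y - β), by simp⟩

theorem predErr_expMeasure_le {H : UnitAddCircle → ℝ≥0∞} (hH : Measurable H) {n : ℕ} {A B h α : ℝ}
    (hA : 0 ≤ A) (hB0 : 0 ≤ B) (h0 : 0 < h) (h1 : h ≤ 1 / 4)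
    (hα : ∀ θ ∈ Set.Ioo α (α + 2 * h), ENNReal.ofReal A < H (θ : UnitAddCircle))
    (hBA : 38 * B ≤ A)
    (htail : Real.exp (19 * B) * (1 + h / 2)⁻¹ ^ (n + 1) / (1 - (1 + h / 2)⁻¹) ≤ 1) :
    predErr (expMeasure H) n ≤ 2 * Real.exp (-(B * h / 4)) := by
  set f : ℂ → ℂ := fun z => Complex.exp (B * arcFun h z) with hf
  have hfn : ∀ z, ‖f z‖ = Real.exp (B * (arcFun h z).re) := fun z => by
    rw [hf, Complex.norm_exp, Complex.re_ofReal_mul]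
  have hfM : ∀ z, ‖z‖ ≤ 1 + h / 2 → ‖f z‖ ≤ Real.exp (19 * B) := fun z hz => by
    rw [hfn, Real.exp_le_exp, mul_comm]
    exact mul_le_mul_of_nonneg_right
      ((Complex.re_le_norm _).trans (norm_arcFun_le h0 h1 hz)) hB0
  obtain ⟨a, ha0, ha⟩ := exists_taylor_approx (by linarith : 1 < 1 + h / 2)
    (diffContOnCl_exp_arcFun h0 h1 B) hfM (n + 1)
  have ha0n : Real.exp (B * h / 4) ≤ ‖a 0‖ := by
    rw [ha0]
    refine le_trans ?_ (hfn 0).ge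
    rw [Real.exp_le_exp, mul_div_assoc]
    exact mul_le_mul_of_nonneg_left (arcFun_zero_re h0 h1) hB0
  have hapos : 0 < ‖a 0‖ := (Real.exp_pos _).trans_le ha0n
  set β := α + h with hβ
  obtain ⟨ω, hω⟩ : ∃ ω : ℂ, ω = (AddCircle.toCircle (β : UnitAddCircle) : ℂ) := ⟨_, rfl⟩
  have hωn : ‖ω‖ = 1 := hω ▸ norm_toCircle _
  set Q : UnitAddCircle → ℂ := fun x =>
    ∑ k ∈ Finset.range (n + 1), a k * (AddCircle.toCircle x * ω⁻¹) ^ k with hQ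
  have hQn : ∀ x, weight H x * ‖Q x‖ ^ 2 ≤ 4 := by
    intro x
    obtain ⟨t, ht, rfl⟩ := exists_abs_le_half_eq β x
    have hz : (AddCircle.toCircle ((β + t : ℝ) : UnitAddCircle) : ℂ) * ω⁻¹ =
        Complex.exp ((2 * Real.pi * t : ℝ) * Complex.I) := by
      rw [hω, AddCircle.toCircle_apply_mk, AddCircle.toCircle_apply_mk, Circle.coe_exp,
        Circle.coe_exp, ← Complex.exp_neg, ← Complex.exp_add]
      congr 1; push_cast; ring
    set z := Complex.exp ((2 * Real.pi * t : ℝ) * Complex.I) with hzdef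
    have hzn : ‖z‖ = 1 := Complex.norm_exp_ofReal_mul_I _
    have hQf : ‖Q ((β + t : ℝ) : UnitAddCircle)‖ ≤ 1 + ‖f z‖ := by
      have e : Q ((β + t : ℝ) : UnitAddCircle) =
          (∑ k ∈ Finset.range (n + 1), a k * z ^ k - f z) + f z := by
        rw [hQ, sub_add_cancel]; simp only [hz]
      rw [e]
      exact (norm_add_le _ _).trans (add_le_add_left ((ha z hzn).trans htail) _)
    -- On the arc the weight `e^{-A}` beats `|Q|² ≤ 4e^{38B}`; off the arc the weight is at most `1`
    -- and `|Q| ≤ 2`.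
    rcases lt_or_ge |t| h with hth | hth
    · have hw := weight_le_of_lt hA (hα (β + t) (by
        rw [abs_lt] at hth; constructor <;> linarith))
      have hM := hfM z (by linarith)
      have h1e : 1 ≤ Real.exp (19 * B) := Real.one_le_exp (by linarith)
      have hq : ‖Q ((β + t : ℝ) : UnitAddCircle)‖ ^ 2 ≤ 4 * Real.exp (38 * B) := by
        calc _ ≤ (2 * Real.exp (19 * B)) ^ 2 := by
              gcongr; linarith
          _ = 4 * Real.exp (38 * B) := by
              rw [mul_pow, ← Real.exp_nat_mul]; push_cast; ring_nf
      calc _ ≤ Real.exp (-A) * (4 * Real.exp (38 * B)) :=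
            mul_le_mul hw hq (by positivity) (Real.exp_pos _).le
        _ = 4 * Real.exp (-A + 38 * B) := by rw [Real.exp_add]; ring
        _ ≤ 4 * 1 := by gcongr; exact Real.exp_le_one_iff.2 (by linarith)
        _ = 4 := mul_one _
    · have hre := arcFun_re_nonpos h0 h1 hth ht
      have hle : ‖f z‖ ≤ 1 := by
        rw [hfn]; exact Real.exp_le_one_iff.2 (mul_nonpos_of_nonneg_of_nonpos hB0 hre)
      calc _ ≤ 1 * (2 : ℝ) ^ 2 := by
            refine mul_le_mul (weight_le_one H _) ?_ (by positivity) zero_le_one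
            gcongr; linarith
        _ = 4 := by norm_num
  have hbdd : BddBelow (Set.range fun q : Fin n → ℂ => √(∫ x : UnitAddCircle,
    ‖(∑ j : Fin n, q j * (AddCircle.toCircle x : ℂ) ^ (j : ℕ))
        + (AddCircle.toCircle x : ℂ) ^ n‖ ^ 2 ∂(expMeasure H))) :=
    ⟨0, by rintro _ ⟨q, rfl⟩; exact Real.sqrt_nonneg _⟩
  refine (ciInf_le hbdd fun j =>
    (starRingEnd ℂ) (a (n - j)) * ω ^ (n - j : ℕ) / (starRingEnd ℂ) (a 0)).trans ?_
  simp only [fun x => norm_monic_of_conj (n := n) a (norm_pos_iff.1 hapos) (norm_toCircle x) hωn]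
  rw [Real.sqrt_le_left (by positivity), integral_expMeasure hH]
  have hpt : ∀ x, weight H x * (‖Q x‖ / ‖a 0‖) ^ 2 ≤ (2 * Real.exp (-(B * h / 4))) ^ 2 := by
    intro x
    rw [div_pow, ← mul_div_assoc, div_le_iff₀ (by positivity)]
    refine (hQn x).trans ?_
    have : 1 ≤ Real.exp (-(B * h / 4)) * ‖a 0‖ := by
      rw [Real.exp_neg, ← div_eq_inv_mul, one_le_div (Real.exp_pos _)]; exact ha0n
    rw [mul_pow, mul_assoc, ← mul_pow]
    nlinarith [one_le_pow₀ this (n := 2)]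
  refine (integral_mono_of_nonneg (ae_of_all _ fun x => mul_nonneg (weight_nonneg H x)
    (by positivity)) (integrable_const _) (ae_of_all _ hpt)).trans_eq ?_
  rw [integral_const, volume_real_univ, one_smul]

/-- With `h = cλ/4` and `B = nh/100`, the growth `e^{0.19 nh}` loses to the decay `e^{-(4/9)nh}`,
leaving `e^{-cA/16}`. This beats the factor of order `1/(cλ)` from the geometric series because `1/λ
≤ A`; the threshold `4608 / c ^ 3` is what the quadratic lower bound for `exp` requires. -/
theorem tail_le_one {n : ℕ} {c A lam : ℝ} (hc : 0 < c) (hc1 : c ≤ 1) (hlam : 0 < lam)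
    (hlam1 : lam ≤ 1) (hA : n * lam = A) (hA1 : 1 ≤ A * lam) (hA2 : 4608 / c ^ 3 ≤ A) :
    Real.exp (19 * (n * (c * lam / 4) / 100)) * (1 + c * lam / 4 / 2)⁻¹ ^ (n + 1) /
      (1 - (1 + c * lam / 4 / 2)⁻¹) ≤ 1 := by
  set h := c * lam / 4 with hh
  have h0 : 0 < h := by positivity
  have h1 : h ≤ 1 / 4 := by rw [hh]; nlinarith
  have hA0 : 0 < A := by nlinarith
  have hnh : n * h = c * A / 4 := by rw [hh, ← hA]; ring
  have hinv : (1 + h / 2)⁻¹ ≤ 1 - 4 / 9 * h := by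
    rw [inv_le_comm₀ (by positivity) (by linarith), inv_le_iff_one_le_mul₀ (by linarith)]
    nlinarith
  have hexp : (1 + h / 2)⁻¹ ≤ Real.exp (-(4 / 9 * h)) :=
    hinv.trans (by linarith [Real.add_one_le_exp (-(4 / 9 * h))])
  have hi1 : (1 + h / 2)⁻¹ ≤ 1 := inv_le_one_of_one_le₀ (by linarith)
  have hi0 : 0 ≤ (1 + h / 2)⁻¹ := by positivity
  have hpow : (1 + h / 2)⁻¹ ^ (n + 1) ≤ Real.exp (-(4 / 9 * (n * h))) := by
    calc (1 + h / 2)⁻¹ ^ (n + 1) ≤ (1 + h / 2)⁻¹ ^ n := pow_le_pow_of_le_one hi0 hi1 n.le_succ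
      _ ≤ Real.exp (-(4 / 9 * h)) ^ n := pow_le_pow_left₀ hi0 hexp n
      _ = _ := by rw [← Real.exp_nat_mul]; congr 1; ring
  rw [div_le_one (by linarith)]
  have hx : 0 ≤ c * A / 16 := by positivity
  have hq := Real.quadratic_le_exp_of_nonneg hx
  have hbig : 9 / (c * lam) ≤ Real.exp (c * A / 16) := by
    have e1 : 9 / (c * lam) ≤ 9 * A / c := by
      rw [div_le_div_iff₀ (by positivity) hc]; nlinarith
    have e2 : 9 * A / c ≤ (c * A / 16) ^ 2 / 2 := by
      rw [div_le_iff₀ (by positivity)] at hA2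
      rw [div_le_iff₀ hc]
      nlinarith
    linarith
  calc Real.exp (19 * (n * h / 100)) * (1 + h / 2)⁻¹ ^ (n + 1)
      ≤ Real.exp (19 * (n * h / 100)) * Real.exp (-(4 / 9 * (n * h))) :=
        mul_le_mul_of_nonneg_left hpow (Real.exp_pos _).le
    _ ≤ Real.exp (-(c * A / 16)) := by
        rw [← Real.exp_add, Real.exp_le_exp, hnh]
        nlinarith [mul_pos hc hA0]
    _ ≤ c * lam / 9 := by
        rw [Real.exp_neg, inv_le_comm₀ (Real.exp_pos _) (by positivity), inv_div]; exact hbig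
    _ ≤ 1 - (1 + h / 2)⁻¹ := by rw [hh] at hinv ⊢; linarith

theorem log_predErr_le {H : UnitAddCircle → ℝ≥0∞} (hH : Measurable H) {n : ℕ} {c A : ℝ}
    (hc : 0 < c) (hc1 : c ≤ 1) (hpos : 0 < distrib H A)
    (hA : n * distrib H A = A) (hA1 : 1 ≤ A * distrib H A) (hA2 : 4608 / c ^ 3 ≤ A)
    (hA3 : 12800 / c ^ 2 ≤ A * distrib H A) (hlong : c * distrib H A ≤ longestArc H A)
    (hpred : 0 < predErr (expMeasure H) n) :
    Real.log (predErr (expMeasure H) n) ≤ -(c ^ 2 / 12800 * (A * distrib H A)) := by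
  have hl1 := distrib_le_one H A
  set lam := distrib H A
  have hA0 : 0 < A := by nlinarith
  -- The supremum of arc lengths need not be attained a priori, so an arc of half the guaranteed
  -- length `c * lam` is used.
  obtain ⟨α, hα⟩ := exists_arc_of_lt_longestArc (H := H) (a := A) (l := 2 * (c * lam / 4))
    (by nlinarith [mul_pos hc hpos])
  have hP := predErr_expMeasure_le hH (n := n) (B := n * (c * lam / 4) / 100) hA0.le
    (by positivity) (by positivity) (by nlinarith) hα (by nlinarith)
    (tail_le_one hc hc1 hpos hl1 hA hA1 hA2)
  refine (Real.log_le_log hpred hP).trans ?_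
  rw [Real.log_mul two_ne_zero (Real.exp_pos _).ne', Real.log_exp]
  have e : n * (c * lam / 4) / 100 * (c * lam / 4) / 4 = c ^ 2 / 6400 * (A * lam) := by
    rw [← hA]; ring
  rw [e]
  -- Half of the exponent `c² Aλ / 6400` is given up to absorb `log 2`.
  rw [div_le_iff₀ (by positivity)] at hA3
  have := Real.log_two_lt_d9
  linarith

end SzegoRate

/-! ### Choice of constants and conclusion. -/

theorem mainTheorem5 (c κ : ℝ) (q : ℝ≥0∞) (hc : 0 < c) (hκ : κ < 1) (hq : q < 2) :
    ∃ K : ℝ, 0 < K ∧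
      ∀ H : UnitAddCircle → ℝ≥0∞,
        LowerSemicontinuous H →
        ∫⁻ x, H x = ∞ →
        volume.real {x : UnitAddCircle | H x = ∞} ≤ κ →
        (∀ᶠ a : ℝ in atTop, c * SzegoRate.distrib H a ≤ SzegoRate.longestArc H a) →
        limsup (fun a : ℝ => ENNReal.ofReal (SzegoRate.distrib H a / SzegoRate.distrib H (2 * a)))
          atTop ≤ q →
        ∃ n₀ : ℕ, ∀ n : ℕ, n₀ ≤ n → ∀ A : ℝ, n * SzegoRate.distrib H A = A →
          K⁻¹ * (A * SzegoRate.distrib H A)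
              ≤ |Real.log (SzegoRate.predErr (SzegoRate.expMeasure H) n)| ∧
            |Real.log (SzegoRate.predErr (SzegoRate.expMeasure H) n)|
              ≤ K * (A * SzegoRate.distrib H A) := by
  obtain ⟨p, -, hqp, hp2⟩ := ENNReal.lt_iff_exists_real_btwn.1 hq
  have hp0 : 0 < p := ENNReal.ofReal_pos.1 (bot_le.trans_lt hqp)
  rw [ENNReal.ofReal_lt_iff_lt_toReal hp0.le (by simp), ENNReal.toReal_ofNat] at hp2
  set d := min c 1 with hd
  have hd0 : 0 < d := lt_min hc one_pos
  have hd1 : d ≤ 1 := min_le_right _ _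
  -- The hypothesis bounds only the measure of `{H = ∞}`; the measures of `{H > a}` decrease to it,
  -- so they eventually fall below any `κ' > κ`.
  set κ' := (1 + κ) / 2 with hκ'
  have hκ1 : κ' < 1 := by rw [hκ']; linarith
  have hk : 0 < 1 - κ' := by linarith
  have hC : 0 ≤ 2 * p / (2 - p) := div_nonneg (by linarith) (by linarith)
  -- The three terms account for the integral of `U` over `F`, the truncated integral of `H`, and
  -- the additive constant `D + 1`, eventually at most `A * distrib H A`.
  set L := (20 / (1 - κ') + 2 * p / (2 - p) + 1) / (1 - κ') with hL
  have hL0 : 0 ≤ L := by positivity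
  refine ⟨12800 / d ^ 2 + L, by positivity, fun H hlsc hI hinf hlong hlim => ?_⟩
  have hH : Measurable H := hlsc.measurable
  have hdouble := SzegoRate.eventually_distrib_le_mul_distrib_two_mul hI hlim hqp
  have htend := SzegoRate.tendsto_mul_distrib hI hp0 hp2 hdouble
  obtain ⟨D, hD⟩ := SzegoRate.exists_truncIntegral_le hH hp0 hp2 hdouble
  have hev := hlong.and <| hD.and <| (SzegoRate.eventually_distrib_le hH hinf
    (by rw [hκ']; linarith : κ < κ')).and <| (htend.eventually_ge_atTop (D + 1)).and <|
    (htend.eventually_ge_atTop (12800 / d ^ 2)).and <| (htend.eventually_ge_atTop 1).and <|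
    eventually_ge_atTop (4608 / d ^ 3)
  obtain ⟨a, ha⟩ := eventually_atTop.1 hev
  obtain ⟨n₀, hn₀⟩ := SzegoRate.exists_forall_le_of_mul_distrib_eq hI a
  refine ⟨n₀, fun n hn A hA => ?_⟩
  obtain ⟨e1, e2, e3, e4, e5, e6, e7⟩ := ha A (hn₀ n hn A hA)
  have hpos := SzegoRate.distrib_pos hI A
  have hx0 : 0 ≤ A * SzegoRate.distrib H A := by linarith
  have hlow := SzegoRate.exp_neg_le_predErr hH e3 hκ1 hpos hA e6
    (B := L * (A * SzegoRate.distrib H A)) (by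
      have : L * (A * SzegoRate.distrib H A) * (1 - κ') =
        20 * (A * SzegoRate.distrib H A) / (1 - κ') +
          (2 * p / (2 - p) + 1) * (A * SzegoRate.distrib H A) := by
        rw [hL]; field_simp; ring
      linarith)
  have hpred := (Real.exp_pos _).trans_le hlow
  have hup := SzegoRate.log_predErr_le hH hd0 hd1 hpos hA e6 e7 e5
    ((mul_le_mul_of_nonneg_right (min_le_left _ _) hpos.le).trans e1) hpred
  have hlog := (Real.le_log_iff_exp_le hpred).2 hlow
  have hd2 : 0 < 12800 / d ^ 2 := by positivity
  have hneg : 0 ≤ d ^ 2 / 12800 * (A * SzegoRate.distrib H A) := by positivity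
  rw [abs_of_nonpos (by linarith)]
  constructor
  · have : (12800 / d ^ 2 + L)⁻¹ ≤ d ^ 2 / 12800 := by
      refine le_of_le_of_eq ?_ (inv_div (12800 : ℝ) (d ^ 2))
      exact inv_anti₀ hd2 (le_add_of_nonneg_right hL0)
    have := mul_le_mul_of_nonneg_right this hx0
    linarith
  · have := mul_nonneg hd2.le hx0
    linarith
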